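/- A two counter machine with input (TCMI) over radix $b$ is a deterministic machine with finitely many states (program lines), a designated initial state, and two counters with values in $\mathbb N$, started in the initial state with both counters $0$. Each line holds one of the instructions $x\leftarrow x+1$; $x\leftarrow x-1$ (impossible if $x=0$); "if $x=0$ then goto $l$"; "goto $l$"; "halt"; or an input command, which consumes the next input symbol from $\{0,1,\dots,b-1,\diamond\}$ and branches on it. Here $x$ is either of the two counters and $\diamond$ is a stop marker, used only at the end of the input. A line with an input command is called a wait state. The TCMI counts in $b$ if for every finite string $I=d_0d_1\dots d_{k-1}$ of radix-$b$ digits (least significant digit first, possibly ending in zeros, possibly empty), when it is input $I\diamond$ it halts with $\sum_{i<k} d_i b^i$ in the first counter and $0$ in the second. Theorem. Let $b\ge 2$. If there exists a TCMI that counts in $b$, then there exists a TCMI $M$ that counts in $b$ such that, for every finite string $I$ of radix-$b$ digits, after being input $I$ the machine $M$ arrives at a wait state in a configuration $(w_I,n^I_1,n^I_2)$ with $\min\{n^I_1,n^I_2\}=0$. -/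

import Mathlib

/-- The input alphabet: the radix-`b` digits together with the stop marker. -/
inductive InputSymbol (b : ℕ) : Type
  | digit (d : Fin b) : InputSymbol b
  | endMarker : InputSymbol b

/-- Instructions of a two counter machine with input. The counters are indexed by `Fin 2` and the
lines of the program by `Q`; every instruction names the line(s) at which control continues. -/
inductive TCMIInstr (b : ℕ) (Q : Type) : Type
  /-- `x ← x + 1`, then go to `next`. -/
  | inc (x : Fin 2) (next : Q) : TCMIInstr b Q
  /-- `x ← x - 1`, then go to `next`; it cannot be carried out when `x = 0`. -/
  | dec (x : Fin 2) (next : Q) : TCMIInstr b Q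
  /-- `if x = 0 then goto l`, otherwise go to `next`. -/
  | ifZero (x : Fin 2) (l next : Q) : TCMIInstr b Q
  /-- `goto l`. -/
  | jump (l : Q) : TCMIInstr b Q
  /-- The block of commands `if I = a goto l a`, one for each input symbol `a`: wait for the next
  input symbol, consume it, and branch on it. -/
  | input (l : InputSymbol b → Q) : TCMIInstr b Q
  /-- `halt`. -/
  | halt : TCMIInstr b Q

/-- A (deterministic) two counter machine with input over the radix-`b` digits and the stop
marker: a finite program with a designated initial line. -/
structure TCMI (b : ℕ) where
  /-- The states (program lines). -/
  Q : Type
  finite_Q : Finite Q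
  /-- The initial state. -/
  q₀ : Q
  /-- The instruction at each line. -/
  instr : Q → TCMIInstr b Q

namespace TCMI

variable {b : ℕ}

/-- A configuration: the current state and the values of the two counters. -/
structure Config (M : TCMI b) where
  state : M.Q
  counter : Fin 2 → ℕ

/-- The initial configuration: the initial state with both counters empty. -/
def init (M : TCMI b) : M.Config := ⟨M.q₀, fun _ => 0⟩

/-- A state is a wait state if its line holds the input commands. -/
def IsWait (M : TCMI b) (q : M.Q) : Prop := ∃ l, M.instr q = TCMIInstr.input l

/-- A state is a halting state if its line holds `halt`. -/
def IsHalt (M : TCMI b) (q : M.Q) : Prop := M.instr q = TCMIInstr.halt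

/-- One move that consumes no input, if there is one. -/
def step (M : TCMI b) (c : M.Config) : Option M.Config :=
  match M.instr c.state with
  | .inc x next => some ⟨next, Function.update c.counter x (c.counter x + 1)⟩
  | .dec x next =>
      if c.counter x = 0 then none
      else some ⟨next, Function.update c.counter x (c.counter x - 1)⟩
  | .ifZero x l next => some ⟨if c.counter x = 0 then l else next, c.counter⟩
  | .jump l => some ⟨l, c.counter⟩
  | .input _ => none
  | .halt => none

/-- `M.Reaches c I c'`: started in `c` and being input the string `I`, the machine reaches `c'`,
having consumed exactly `I`. -/
inductive Reaches (M : TCMI b) : M.Config → List (InputSymbol b) → M.Config → Prop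
  | refl (c : M.Config) : Reaches M c [] c
  | step {c c' c'' : M.Config} {I : List (InputSymbol b)} :
      M.step c = some c' → Reaches M c' I c'' → Reaches M c I c''
  | read {c c'' : M.Config} {l : InputSymbol b → M.Q} {a : InputSymbol b}
      {I : List (InputSymbol b)} :
      M.instr c.state = TCMIInstr.input l → Reaches M ⟨l a, c.counter⟩ I c'' →
        Reaches M c (a :: I) c''

/-- `M` counts in radix `b`: after being input any string of radix-`b` digits, least significant
digit first, followed by the stop marker, it halts with the value of the string in the first
counter and with the second counter empty. -/
def Counts (M : TCMI b) : Prop :=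
  ∀ I : List (Fin b), ∃ c : M.Config,
    M.Reaches M.init (I.map InputSymbol.digit ++ [InputSymbol.endMarker]) c ∧ M.IsHalt c.state ∧
      c.counter 0 = Nat.ofDigits b (I.map Fin.val) ∧ c.counter 1 = 0

/-- After every string of digits `M` arrives at a wait state with at least one counter empty.
(Moves are deterministic and none without input is possible in a wait state, so the configuration
below is determined by `I`.) -/
def HasEmptyCounterAtWaits (M : TCMI b) : Prop :=
  ∀ I : List (Fin b), ∃ c : M.Config,
    M.Reaches M.init (I.map InputSymbol.digit) c ∧ M.IsWait c.state ∧
      min (c.counter 0) (c.counter 1) = 0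

end TCMI

/-! The key fact is `TCMI.Counts.exists_bound`: in a machine that counts, one of the counters is at
most a constant `C` at every wait. `TCMI.emptying` then moves a counter of value at most `C` into
the finite control before each wait and restores it after the symbol is read.

For the key fact, suppose both counters can be arbitrarily large at waits. Far from the axes the
zero tests always fail, so a line recurs and the run contains a cycle with fixed displacement `e`
that consumes a nonempty string `s` (`exists_cycle_of_large`). Repeating it `t` times and then
feeding `1⋄` makes the machine halt from counters `n + t • e` with the value of `u sᵗ 1`, which
grows exponentially in `t`.

This is impossible without further input (`false_of_nowhereAffine_families`). The machine falls into
a loop that carries a thinned-out family to points with one fixed small counter and the other in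
arithmetic progression (`exists_axis_family`). From such a point, a run whose output is too large to
come from a small configuration reacts affinely to suitable increases of the large counter
(`exists_affine_output`). Pigeonhole on residues puts a point of one family in line with a longer
family, whose outputs would then contain an affine stretch. -/

/-! ### Two counter machines without input: halting and loops away from the axes. -/

/-- A deterministic machine with two integer counters. Each move depends on the state and on which
counters vanish. Moves are total; the machine halts by staying put in a state of `H`. -/
structure CounterSystem (S : Type) where
  /-- The next state. -/
  nxt : S → (Fin 2 → Bool) → S
  /-- The change of the counters. -/
  dlt : S → (Fin 2 → Bool) → Fin 2 → ℤ
  /-- The halting states. -/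
  H : Set S
  abs_dlt_le : ∀ s z x, |dlt s z x| ≤ 1
  dlt_nonneg : ∀ s z x, z x = true → 0 ≤ dlt s z x
  nxt_halt : ∀ s z, s ∈ H → nxt s z = s
  dlt_halt : ∀ s z, s ∈ H → dlt s z = 0

namespace CounterSystem

variable {S : Type} (T : CounterSystem S)

/-- One move. -/
def step (c : S × (Fin 2 → ℤ)) : S × (Fin 2 → ℤ) :=
  (T.nxt c.1 (fun x => decide (c.2 x = 0)), c.2 + T.dlt c.1 (fun x => decide (c.2 x = 0)))

/-- The next state when no counter vanishes. -/
def fr (s : S) : S := T.nxt s (fun _ => false)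

/-- The displacement of the counters in `k` moves during which no counter vanishes. -/
def disp : ℕ → S → Fin 2 → ℤ
  | 0, _ => 0
  | k + 1, s => T.dlt s (fun _ => false) + disp k (T.fr s)

/-- Started in `c`, the machine halts within `k` moves and the first counter is then `o`. -/
def HaltsIn (k : ℕ) (c : S × (Fin 2 → ℤ)) (o : ℤ) : Prop :=
  (T.step^[k] c).1 ∈ T.H ∧ (T.step^[k] c).2 0 = o

/-- Started in `c`, the machine halts and the first counter is then `o`. -/
def Halts (c : S × (Fin 2 → ℤ)) (o : ℤ) : Prop := ∃ k, T.HaltsIn k c o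

variable {T}

theorem step_of_mem {c : S × (Fin 2 → ℤ)} (h : c.1 ∈ T.H) : T.step c = c := by
  ext1
  · simp [step, T.nxt_halt _ _ h]
  · simp [step, T.dlt_halt _ _ h]

theorem iterate_step_of_mem {c : S × (Fin 2 → ℤ)} (h : c.1 ∈ T.H) (k : ℕ) : T.step^[k] c = c :=
  Function.iterate_fixed (step_of_mem h) k

/-- Halting configurations are fixed points, so the truncated `k - m` is right even when `m` exceeds
`k`. -/
theorem HaltsIn.iterate {k : ℕ} {c : S × (Fin 2 → ℤ)} {o : ℤ} (h : T.HaltsIn k c o) (m : ℕ) :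
    T.HaltsIn (k - m) (T.step^[m] c) o := by
  unfold HaltsIn
  rw [← Function.iterate_add_apply]
  rcases le_total m k with hm | hm
  · rwa [Nat.sub_add_cancel hm]
  · obtain ⟨a, rfl⟩ := Nat.exists_eq_add_of_le' hm
    rw [Nat.sub_eq_zero_of_le hm, zero_add, Function.iterate_add_apply, iterate_step_of_mem h.1]
    exact h

theorem HaltsIn.halts {k : ℕ} {c : S × (Fin 2 → ℤ)} {o : ℤ} (h : T.HaltsIn k c o) : T.Halts c o :=
  ⟨k, h⟩

theorem Halts.iterate {c : S × (Fin 2 → ℤ)} {o : ℤ} (h : T.Halts c o) (m : ℕ) :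
    T.Halts (T.step^[m] c) o := by
  obtain ⟨k, h⟩ := h
  exact (h.iterate m).halts

theorem Halts.of_iterate {c : S × (Fin 2 → ℤ)} {o : ℤ} {m : ℕ} (h : T.Halts (T.step^[m] c) o) :
    T.Halts c o := by
  obtain ⟨k, h⟩ := h
  refine ⟨k + m, ?_⟩
  unfold HaltsIn at *
  rwa [Function.iterate_add_apply]

theorem Halts.unique {c : S × (Fin 2 → ℤ)} {o o' : ℤ} (h : T.Halts c o) (h' : T.Halts c o') :
    o = o' := by
  obtain ⟨k, h⟩ := h
  obtain ⟨k', h'⟩ := h'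
  have h1 : T.step^[k'] (T.step^[k] c) = T.step^[k] c := iterate_step_of_mem h.1 _
  have h2 : T.step^[k] (T.step^[k'] c) = T.step^[k'] c := iterate_step_of_mem h'.1 _
  rw [← Function.iterate_add_apply] at h1 h2
  rw [← h.2, ← h'.2, ← h1, ← h2, add_comm]

theorem step_nonneg {c : S × (Fin 2 → ℤ)} (h : ∀ x, 0 ≤ c.2 x) (x : Fin 2) :
    0 ≤ (T.step c).2 x := by
  simp only [step, Pi.add_apply]
  have h1 := T.abs_dlt_le c.1 (fun x => decide (c.2 x = 0)) x
  have h2 := T.dlt_nonneg c.1 (fun x => decide (c.2 x = 0)) x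
  have h3 := h x
  rw [abs_le] at h1
  by_cases h0 : c.2 x = 0
  · have := h2 (by simpa using h0)
    omega
  · omega

theorem iterate_step_nonneg {c : S × (Fin 2 → ℤ)} (h : ∀ x, 0 ≤ c.2 x) (k : ℕ) :
    ∀ x, 0 ≤ (T.step^[k] c).2 x := by
  induction k with
  | zero => exact h
  | succ k ih => rw [Function.iterate_succ_apply']; exact step_nonneg ih

theorem abs_step_sub_le (c : S × (Fin 2 → ℤ)) (x : Fin 2) : |(T.step c).2 x - c.2 x| ≤ 1 := by
  simpa [step] using T.abs_dlt_le c.1 (fun x => decide (c.2 x = 0)) x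

theorem abs_iterate_step_sub_le (c : S × (Fin 2 → ℤ)) (k : ℕ) (x : Fin 2) :
    |(T.step^[k] c).2 x - c.2 x| ≤ k := by
  induction k with
  | zero => simp
  | succ k ih =>
    rw [Function.iterate_succ_apply']
    have := abs_step_sub_le (T := T) (T.step^[k] c) x
    rw [abs_le] at *
    push_cast
    omega

theorem abs_disp_le (k : ℕ) (s : S) (x : Fin 2) : |T.disp k s x| ≤ k := by
  induction k generalizing s with
  | zero => simp [disp]
  | succ k ih =>
    have h1 := T.abs_dlt_le s (fun _ => false) x
    have h2 := ih (T.fr s)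
    simp only [disp, Pi.add_apply]
    rw [abs_le] at *
    push_cast
    omega

theorem step_free {s : S} {n : Fin 2 → ℤ} (h : ∀ x, 1 ≤ n x) :
    T.step (s, n) = (T.fr s, n + T.dlt s (fun _ => false)) := by
  have : (fun x => decide (n x = 0)) = fun _ => false := by
    funext x
    have := h x
    simp only [decide_eq_false_iff_not]
    omega
  simp [step, fr, this]

theorem iterate_step_free (k : ℕ) (s : S) (n : Fin 2 → ℤ) (h : ∀ x, (k : ℤ) ≤ n x) :
    T.step^[k] (s, n) = (T.fr^[k] s, n + T.disp k s) := by
  induction k generalizing s n with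
  | zero => simp [disp]
  | succ k ih =>
    have h1 : ∀ x, 1 ≤ n x := fun x => by have := h x; push_cast at this; omega
    rw [Function.iterate_succ_apply, step_free h1, ih, Function.iterate_succ_apply, disp, add_assoc]
    intro x
    have h2 := T.abs_dlt_le s (fun _ => false) x
    have := h x
    push_cast at this
    rw [abs_le] at h2
    simp only [Pi.add_apply]
    omega

/-- The counters after each round are affine in the number of rounds, so bounds at both ends cover
all rounds between; `p` is enough to survive one round. -/
theorem iterate_step_loop {p : ℕ} {s : S} (hs : T.fr^[p] s = s) (l : ℕ) (n : Fin 2 → ℤ)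
    (h0 : ∀ x, (p : ℤ) ≤ n x) (h1 : ∀ x, (p : ℤ) ≤ n x + l * T.disp p s x) :
    T.step^[l * p] (s, n) = (s, n + (l : ℤ) • T.disp p s) := by
  induction l with
  | zero => simp
  | succ l ih =>
    have h2 : ∀ x, (p : ℤ) ≤ n x + l * T.disp p s x := by
      intro x
      have a := h0 x
      have b := h1 x
      push_cast at b
      rcases le_total 0 (T.disp p s x) with hd | hd
      · nlinarith
      · nlinarith
    rw [add_mul, one_mul, add_comm, Function.iterate_add_apply, ih h2, iterate_step_free, hs]
    · congr 1
      push_cast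
      rw [add_smul, one_smul, add_assoc]
    · intro x
      simpa using h2 x

/-- Running freely for `p` moves and then `l` times around the loop reached. -/
theorem iterate_step_to_loop {p : ℕ} (hp : ∀ s, T.fr^[p] (T.fr^[p] s) = T.fr^[p] s) (s : S) (l : ℕ)
    (n : Fin 2 → ℤ) (h : ∀ x, (p : ℤ) ≤ n x) (h0 : ∀ x, (p : ℤ) ≤ n x + T.disp p s x)
    (h1 : ∀ x, (p : ℤ) ≤ n x + T.disp p s x + l * T.disp p (T.fr^[p] s) x) :
    T.step^[l * p + p] (s, n) =
      (T.fr^[p] s, n + T.disp p s + (l : ℤ) • T.disp p (T.fr^[p] s)) := by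
  rw [Function.iterate_add_apply, iterate_step_free p s n h, iterate_step_loop (hp s)]
  · exact h0
  · exact h1

theorem step_add_single {s : S} {n : Fin 2 → ℤ} {y : Fin 2} (hy : 0 < n y) {a : ℤ} (ha : 0 ≤ a) :
    T.step (s, n + Pi.single y a) =
      ((T.step (s, n)).1, (T.step (s, n)).2 + Pi.single y a) := by
  have : (fun x => decide ((n + Pi.single y a : Fin 2 → ℤ) x = 0)) = fun x => decide (n x = 0) := by
    funext x
    by_cases hx : x = y
    · subst hx
      simp only [Pi.add_apply, Pi.single_eq_same]
      rw [decide_eq_decide]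
      omega
    · simp [hx]
  simp only [step, this]
  rw [add_right_comm]

/-- Iterates of a self-map of a finite type are eventually idempotent. -/
theorem exists_iterate_idempotent {α : Type} [Finite α] (f : α → α) :
    ∃ p, 1 ≤ p ∧ ∀ a, f^[p] (f^[p] a) = f^[p] a := by
  obtain ⟨m, n, hmn, h⟩ := Finite.exists_ne_map_eq_of_infinite (fun k : ℕ => f^[k])
  wlog hlt : m < n generalizing m n
  · exact this n m hmn.symm h.symm (by omega)
  obtain ⟨d, rfl⟩ := Nat.exists_eq_add_of_lt hlt
  have key : ∀ j k, m ≤ k → f^[k + j * (d + 1)] = f^[k] := by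
    intro j
    induction j with
    | zero => simp
    | succ j ih =>
      intro k hk
      rw [add_mul, one_mul, ← add_assoc, add_right_comm, ih _ (by omega)]
      obtain ⟨i, rfl⟩ := Nat.exists_eq_add_of_le hk
      change f^[m] = f^[m + d + 1] at h
      rw [show m + i + (d + 1) = i + (m + d + 1) by ring, Function.iterate_add, ← h,
        ← Function.iterate_add, add_comm]
  -- A multiple of the period `d + 1` that is at least the preperiod `m`.
  refine ⟨(m + 1) * (d + 1), by nlinarith, fun a => ?_⟩
  rw [← Function.iterate_add_apply, key _ _ (by nlinarith)]

/-- The outputs of the configurations with small counters are bounded. -/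
theorem exists_output_bound [Finite S] (K : ℤ) :
    ∃ V : ℤ, ∀ s n o, (∀ x, 0 ≤ n x) → (∀ x, n x ≤ K) → T.Halts (s, n) o → o ≤ V := by
  classical
  -- The dummy value 0 at configurations that never halt does no harm to an upper bound.
  let out : S × (Fin 2 → ℤ) → ℤ := fun c => if h : ∃ o, T.Halts c o then h.choose else 0
  have hfin : ((Set.univ : Set S) ×ˢ Set.Icc (0 : Fin 2 → ℤ) (fun _ => K)).Finite :=
    Set.finite_univ.prod (Set.finite_Icc _ _)
  obtain ⟨V, hV⟩ := (hfin.image out).bddAbove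
  refine ⟨V, fun s n o h0 hK h => ?_⟩
  have hex : ∃ o, T.Halts (s, n) o := ⟨o, h⟩
  have : out (s, n) = o := by
    simp only [out, dif_pos hex]
    exact hex.choose_spec.unique h
  rw [← this]
  exact hV ⟨(s, n), ⟨trivial, h0, hK⟩, rfl⟩

end CounterSystem

/-! ### Affine dependence of the output on a large counter. -/

namespace CounterSystem

variable {S : Type} {T : CounterSystem S}

theorem iterate_step_add_single_free {p : ℕ} {s : S} {n : Fin 2 → ℤ} (h : ∀ x, (p : ℤ) ≤ n x)
    (y : Fin 2) {a : ℤ} (ha : 0 ≤ a) :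
    T.step^[p] (s, n + Pi.single y a) = (T.fr^[p] s, n + T.disp p s + Pi.single y a) := by
  rw [iterate_step_free, add_right_comm]
  intro x
  have := h x
  have h2 : 0 ≤ (Pi.single y a : Fin 2 → ℤ) x := by
    rcases eq_or_ne x y with rfl | hx
    · simpa using ha
    · simp [hx]
  simp only [Pi.add_apply]
  omega

/-- The number of times `a` can be subtracted from `u` without getting below `p`. -/
theorem exists_loop_count {u a p : ℤ} (ha : 0 < a) (hap : a ≤ p) (hu : p ≤ u) :
    ∃ l : ℕ, p ≤ u - l * a ∧ u - l * a < 2 * p := by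
  refine ⟨((u - p) / a).toNat, ?_⟩
  have h0 : 0 ≤ (u - p) / a := Int.ediv_nonneg (by omega) ha.le
  rw [Int.toNat_of_nonneg h0]
  have h1 := Int.emod_add_mul_ediv (u - p) a
  have h2 := Int.emod_nonneg (u - p) ha.ne'
  have h3 := Int.emod_lt_of_pos (u - p) ha
  rw [mul_comm] at h1
  constructor <;> omega

/-- If a run from a configuration with one small counter never visits small configurations, then
starting with the other counter increased along a suitable arithmetic progression changes the
output affinely. -/
theorem exists_affine_output {p : ℕ} (hp1 : 1 ≤ p)
    (hp : ∀ s, T.fr^[p] (T.fr^[p] s) = T.fr^[p] s) {V : ℤ}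
    (hV : ∀ s n o, (∀ x, 0 ≤ n x) → (∀ x, n x ≤ 4 * (p : ℤ) * p + 10 * p) →
      T.Halts (s, n) o → o ≤ V) (k : ℕ) :
    ∀ (x y : Fin 2) (s : S) (n : Fin 2 → ℤ) (o : ℤ), x ≠ y → (∀ z, 0 ≤ n z) → n x ≤ 3 * p →
      T.HaltsIn k (s, n) o → V < o →
      ∃ (D : ℕ) (A : ℤ), 1 ≤ D ∧
        ∀ j : ℕ, T.Halts (s, n + Pi.single y ((j : ℤ) * D)) (o + j * A) := by
  induction k using Nat.strong_induction_on with
  | _ k ih =>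
  intro x y s n o hxy hn hnx hk hVo
  have hall : ∀ z, z = x ∨ z = y := by intro z; omega
  have hp1' : (1 : ℤ) ≤ p := by exact_mod_cast hp1
  have hpp : (p : ℤ) ≤ p * p := by nlinarith
  -- An output above `V` excludes small configurations, so `y` must be large.
  have hny : 4 * (p : ℤ) * p + 10 * p < n y := by
    by_contra hcon
    push Not at hcon
    refine absurd (hV s n o hn (fun z => ?_) hk.halts) (by omega)
    rcases hall z with rfl | rfl
    · nlinarith
    · exact hcon
  have hhalt : ∀ m : ℕ, ∀ n' : Fin 2 → ℤ, ∀ s', s' ∈ T.H → T.step^[m] (s, n) = (s', n') →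
      (∀ a : ℤ, 0 ≤ a →
        T.step^[m] (s, n + Pi.single y a) = (s', n' + Pi.single y a)) →
      ∃ (D : ℕ) (A : ℤ), 1 ≤ D ∧
        ∀ j : ℕ, T.Halts (s, n + Pi.single y ((j : ℤ) * D)) (o + j * A) := by
    intro m n' s' hs' hm hm'
    refine ⟨1, (Pi.single y 1 : Fin 2 → ℤ) 0, le_rfl, fun j => Halts.of_iterate (m := m) ?_⟩
    rw [hm' _ (by positivity)]
    have h1 := hk.halts.iterate m
    rw [hm] at h1
    have h2 : T.Halts (s', n') (n' 0) := ⟨0, hs', rfl⟩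
    refine ⟨0, hs', ?_⟩
    rw [h1.unique h2]
    simp only [Function.iterate_zero, id_eq, Pi.add_apply, add_right_inj, Nat.cast_one, mul_one]
    rcases eq_or_ne (0 : Fin 2) y with rfl | h
    · simp
    · simp [h]
  -- If the first `m` moves do not notice an increase of `y`, the induction hypothesis after them
  -- carries back with the same `D` and `A`.
  have hsync : ∀ m : ℕ, ∀ n' : Fin 2 → ℤ, ∀ s', 1 ≤ m → T.step^[m] (s, n) = (s', n') →
      n' x ≤ 3 * p → (∀ a : ℤ, 0 ≤ a →
        T.step^[m] (s, n + Pi.single y a) = (s', n' + Pi.single y a)) → 1 ≤ k →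
      ∃ (D : ℕ) (A : ℤ), 1 ≤ D ∧
        ∀ j : ℕ, T.Halts (s, n + Pi.single y ((j : ℤ) * D)) (o + j * A) := by
    intro m n' s' hm1 hm hx' hm' hk1
    have hnn := iterate_step_nonneg (T := T) (c := (s, n)) hn m
    have hki := hk.iterate m
    rw [hm] at hnn hki
    obtain ⟨D, A, hD, hDA⟩ := ih (k - m) (by omega) x y s' n' o hxy hnn hx' hki hVo
    refine ⟨D, A, hD, fun j => Halts.of_iterate (m := m) ?_⟩
    rw [hm' _ (by positivity)]
    exact hDA j
  rcases Nat.eq_zero_or_pos k with rfl | hk1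
  · exact hhalt 0 n s hk.1 rfl fun a ha => rfl
  rcases le_or_gt (n x) (2 * p) with hx2 | hx2
  · refine hsync 1 (T.step (s, n)).2 (T.step (s, n)).1 le_rfl rfl ?_ ?_ hk1
    · have := abs_step_sub_le (T := T) (s, n) x
      rw [abs_le] at this
      simp only at this
      omega
    · intro a ha
      exact step_add_single (by nlinarith) ha
  have hnp : ∀ z, 2 * (p : ℤ) ≤ n z := by
    intro z
    rcases hall z with rfl | rfl
    · omega
    · nlinarith
  have hdisp := fun z => abs_le.1 (abs_disp_le (T := T) p s z)
  have hloop := fun z => abs_le.1 (abs_disp_le (T := T) p (T.fr^[p] s) z)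
  have hn'p : ∀ z, (p : ℤ) ≤ n z + T.disp p s z := by
    intro z
    have h1 := hdisp z
    have h2 := hnp z
    omega
  set s' := T.fr^[p] s with hs'
  set d := T.disp p s' with hd
  set c := T.disp p s with hc
  have hrun : ∀ (l : ℕ) (m : Fin 2 → ℤ), (∀ z, n z ≤ m z) →
      (∀ z, (p : ℤ) ≤ m z + c z + l * d z) →
      T.step^[l * p + p] (s, m) = (s', m + c + (l : ℤ) • d) := by
    intro l m hm h1
    refine iterate_step_to_loop hp s l m (fun z => ?_) (fun z => ?_) h1
    · have := hm z
      have := hnp z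
      omega
    · have h2 := hm z
      have h3 := hn'p z
      change (p : ℤ) ≤ m z + c z
      omega
  have hle : ∀ a : ℤ, 0 ≤ a → ∀ z, n z ≤ (n + Pi.single y a : Fin 2 → ℤ) z := by
    intro a ha z
    rcases eq_or_ne z y with rfl | hz
    · simpa using ha
    · simp [hz]
  rcases lt_or_ge (d x) 0 with hdx | hdx
  · obtain ⟨l, hl1, hl2⟩ := exists_loop_count (u := n x + c x) (a := -d x) (p := p) (by omega)
      (by have := hloop x; omega) (hn'p x)
    -- `x` enters the loop with at most `4p` and loses at least 1 per round; hence the rounds cost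
    -- `y` at most `4p²`.
    have hl4 : (l : ℤ) ≤ 4 * p := by
      have := hdisp x
      nlinarith
    have hly : (p : ℤ) ≤ n y + c y + l * d y := by
      have h1 := hloop y
      have h2 := hdisp y
      have h3 : -(4 * (p : ℤ) * p) ≤ l * d y := by nlinarith
      nlinarith
    have hlp : ∀ z, (p : ℤ) ≤ n z + c z + l * d z := by
      intro z
      rcases hall z with rfl | rfl
      · linarith
      · exact hly
    refine hsync (l * p + p) (n + c + (l : ℤ) • d) s' (by omega) (hrun l n (fun _ => le_rfl) hlp)
      ?_ (fun a ha => ?_) hk1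
    · simp only [Pi.add_apply, Pi.smul_apply, smul_eq_mul]
      linarith
    · rw [hrun l _ (hle a ha)]
      · congr 1
        abel
      · intro z
        have := hle a ha z
        have := hlp z
        omega
  rcases lt_or_ge (d y) 0 with hdy | hdy
  · obtain ⟨l, hl1, hl2⟩ := exists_loop_count (u := n y + c y) (a := -d y) (p := p) (by omega)
      (by have := hloop y; omega) (hn'p y)
    have hlp : ∀ z, (p : ℤ) ≤ n z + c z + l * d z := by
      intro z
      rcases hall z with rfl | rfl
      · have := hn'p z
        nlinarith
      · linarith
    have hm := hrun l n (fun _ => le_rfl) hlp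
    have hnn := iterate_step_nonneg (T := T) (c := (s, n)) hn (l * p + p)
    have hki := hk.iterate (l * p + p)
    rw [hm] at hnn hki
    obtain ⟨D, A, hD, hDA⟩ := ih (k - (l * p + p)) (by omega) y x s' _ o hxy.symm hnn
      (by simp only [Pi.add_apply, Pi.smul_apply, smul_eq_mul]; linarith) hki hVo
    have hndy : ((-d y).toNat : ℤ) = -d y := Int.toNat_of_nonneg (by omega)
    have hndx : ((d x).toNat : ℤ) = d x := Int.toNat_of_nonneg (by omega)
    -- The counters have swapped roles. Adding `j * (-d y) * D` to `y` buys exactly `j * D` more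
    -- rounds, which end with the same `y` and with `x` larger by `j * d x * D`.
    refine ⟨(-d y).toNat * D, d x * A, ?_, fun j =>
      Halts.of_iterate (m := (l + j * D) * p + p) ?_⟩
    · have : 1 ≤ (-d y).toNat := by omega
      nlinarith
    · have hconf : n + Pi.single y ((j : ℤ) * ((-d y).toNat * D : ℕ)) + c +
          ((l + j * D : ℕ) : ℤ) • d =
          n + c + (l : ℤ) • d + Pi.single x (((j * (d x).toNat : ℕ) : ℤ) * D) := by
        funext z
        rcases hall z with rfl | rfl
        · simp [hxy, hndx]
          ring
        · simp [hxy.symm, hndy]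
          ring
      rw [hrun (l + j * D), hconf]
      · convert hDA (j * (d x).toNat) using 1
        push_cast
        rw [hndx]
        ring
      · exact hle _ (by positivity)
      · intro z
        have h1 := congrFun hconf z
        have h2 := hlp z
        have h3 : 0 ≤ (Pi.single x (((j * (d x).toNat : ℕ) : ℤ) * D) : Fin 2 → ℤ) z := by
          rcases eq_or_ne z x with rfl | hz
          · simp only [Pi.single_eq_same]
            positivity
          · simp [hz]
        simp only [Pi.add_apply, Pi.smul_apply, smul_eq_mul] at h1 ⊢
        rw [h1]
        omega
  · have hlp : ∀ (l : ℕ) z, (p : ℤ) ≤ n z + c z + l * d z := by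
      intro l z
      have h1 := hn'p z
      rcases hall z with rfl | rfl
      · nlinarith
      · nlinarith
    -- No counter decreases, so the loop goes on forever; a halting run can do this only by staying
    -- put.
    have hH : s' ∈ T.H := by
      have h1 := hk.iterate (k * p + p)
      rw [hrun k n (fun _ => le_rfl) (hlp k), Nat.sub_eq_zero_of_le (by nlinarith)] at h1
      exact h1.1
    refine hhalt p (n + c) s' hH ?_ fun a ha => ?_
    · exact iterate_step_free p s n fun z => by have := hnp z; omega
    · exact iterate_step_add_single_free (fun z => by have := hnp z; omega) y ha

end CounterSystem

/-! ### Linear families of halting configurations. -/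

theorem exists_frequently_of_finite {α : Type} [Finite α] {P : ℕ → α → Prop}
    (h : ∀ L, ∃ a, P L a) : ∃ a, ∀ L, ∃ L' ≥ L, P L' a := by
  by_contra hcon
  push Not at hcon
  choose B hB using hcon
  obtain ⟨L, hL⟩ := (Set.finite_range B).bddAbove
  obtain ⟨a, ha⟩ := h L
  exact hB a L (hL ⟨a, rfl⟩) ha

/-- `F` is affine on no three-term arithmetic progression in `[0, M]` with difference at
least `2`. -/
def NowhereAffine (M : ℕ) (F : ℕ → ℤ) : Prop :=
  ∀ t h, 2 ≤ h → t + 2 * h ≤ M → F t + F (t + 2 * h) ≠ 2 * F (t + h)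

namespace CounterSystem

variable {S : Type} {T : CounterSystem S}

/-- A long linear family of halting configurations with large counters can be run until one counter
is small, which gives a long linear family in the other counter. -/
theorem exists_axis_family {p : ℕ} (hp1 : 1 ≤ p)
    (hp : ∀ s, T.fr^[p] (T.fr^[p] s) = T.fr^[p] s) (s : S) (e : Fin 2 → ℤ)
    (h : ∀ L : ℕ, ∃ (n : Fin 2 → ℤ) (f : ℕ → ℤ), NowhereAffine L f ∧ ∀ t : ℕ, t ≤ L →
      (∀ x, (L : ℤ) ≤ n x + t * e x) ∧ T.Halts (s, n + (t : ℤ) • e) (f t) ∧ (t : ℤ) ≤ f t) :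
    ∃ β : Fin 2 → ℤ, (∀ x, 0 ≤ β x) ∧ ∀ M : ℕ, ∃ (x : Fin 2) (r : ℕ) (X : ℤ) (F : ℕ → ℤ),
      r < 2 * p ∧ 0 ≤ X ∧ NowhereAffine M F ∧ (∃ t ≤ M, (M : ℤ) ≤ F t) ∧
      ∀ t : ℕ, t ≤ M →
        T.Halts (T.fr^[p] s, Function.update (fun _ => X + t * β x) x (r : ℤ)) (F t) := by
  set s' := T.fr^[p] s with hs'
  set d := T.disp p s' with hd
  set c := T.disp p s with hc
  have hp1' : (1 : ℤ) ≤ p := by exact_mod_cast hp1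
  have hdisp : ∀ z, -(p : ℤ) ≤ c z ∧ c z ≤ p := fun z => abs_le.1 (abs_disp_le p s z)
  have hloop : ∀ z, -(p : ℤ) ≤ d z ∧ d z ≤ p := fun z => abs_le.1 (abs_disp_le p s' z)
  -- Every possible loss per round divides `p!`; along indices that are multiples of `p!`, whole
  -- rounds absorb the change of the shrinking counter.
  set q : ℤ := (p.factorial : ℤ) with hq
  have hq1 : 1 ≤ q := by
    have := Nat.factorial_pos p
    omega
  have hm : ∀ x, ∃ m : ℤ, d x < 0 → m * (-d x) = q := by
    intro x
    by_cases hx : d x < 0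
    · have hdvd : (-d x) ∣ q := by
        have h1 : ((-d x).toNat : ℤ) = -d x := Int.toNat_of_nonneg (by omega)
        rw [← h1, hq, Int.natCast_dvd_natCast]
        refine Nat.dvd_factorial (by omega) ?_
        have := hloop x
        omega
      obtain ⟨m, hm⟩ := hdvd
      exact ⟨m, fun _ => by rw [hm]; ring⟩
    · exact ⟨0, fun h => absurd h hx⟩
  choose m hm using hm
  -- The increment of the other counter when `x` has been run down. It depends only on `s` and `e`,
  -- so `β` is uniform in `M`.
  let B : Fin 2 → ℤ := fun x => q * e (1 - x) + m x * e x * d (1 - x)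
  refine ⟨fun x => |B x|, fun x => abs_nonneg _, fun M => ?_⟩
  have hother : ∀ x z : Fin 2, z = x ∨ z = 1 - x := by decide
  have hne : ∀ x : Fin 2, 1 - x ≠ x := by decide
  have hinv : ∀ x : Fin 2, 1 - (1 - x) = x := by decide
  -- Room for the indices `p! * t` with `t ≤ 2 * M`, for entering the loop, and for the progression
  -- 0, 2, 4.
  obtain ⟨n, f, hf, hn⟩ := h (2 * M * p.factorial + 3 * p + 4)
  set L := 2 * M * p.factorial + 3 * p + 4 with hL
  have hLp : 3 * (p : ℤ) ≤ (L : ℤ) := by rw [hL]; push_cast; nlinarith [Nat.factorial_pos p]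
  have hlow : ∀ t : ℕ, t ≤ L → ∀ z, 2 * (p : ℤ) ≤ n z + t * e z + c z := by
    intro t ht z
    have h1 := (hn t ht).1 z
    have h2 := hdisp z
    omega
  have hrun : ∀ t : ℕ, t ≤ L → ∀ l : ℕ, (∀ z, (p : ℤ) ≤ n z + t * e z + c z + l * d z) →
      T.Halts (s', n + (t : ℤ) • e + c + (l : ℤ) • d) (f t) := by
    intro t ht l hl
    have h1 := (hn t ht).2.1.iterate (l * p + p)
    rwa [iterate_step_to_loop hp s l] at h1
    · intro z
      have := (hn t ht).1 z
      simp only [Pi.add_apply, Pi.smul_apply, smul_eq_mul]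
      omega
    · intro z
      have := hlow t ht z
      simp only [Pi.add_apply, Pi.smul_apply, smul_eq_mul]
      change (p : ℤ) ≤ n z + t * e z + c z
      omega
    · simpa using hl
  by_cases hpos : ∀ x, 0 ≤ d x
  · exfalso
    have hfree : ∀ t : ℕ, t ≤ L → ∀ (l : ℕ) z, (p : ℤ) ≤ n z + t * e z + c z + l * d z := by
      intro t ht l z
      have h1 := hlow t ht z
      have h2 := hpos z
      have h3 : 0 ≤ (l : ℤ) * d z := by positivity
      omega
    have hH : s' ∈ T.H := by
      obtain ⟨k, hk⟩ := hrun 0 (Nat.zero_le _) 0 (hfree 0 (Nat.zero_le _) 0)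
      have h1 := hk.iterate (k * p)
      rw [iterate_step_loop (hp s), Nat.sub_eq_zero_of_le (by nlinarith)] at h1
      · exact h1.1
      · simpa using hfree 0 (Nat.zero_le _) 0
      · simpa using hfree 0 (Nat.zero_le _) k
    have hout : ∀ t : ℕ, t ≤ L → f t = n 0 + t * e 0 + c 0 := by
      intro t ht
      have h1 := hrun t ht 0 (hfree t ht 0)
      refine h1.unique ⟨0, hH, ?_⟩
      simp
    refine hf 0 2 le_rfl (by omega) ?_
    rw [hout _ (by omega), hout _ (by omega), hout _ (by omega)]
    push_cast
    ring
  have hl : ∀ x, ∃ l : ℕ, d x < 0 →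
      (p : ℤ) ≤ n x + c x + l * d x ∧ n x + c x + l * d x < 2 * p := by
    intro x
    by_cases hx : d x < 0
    · obtain ⟨l, h1, h2⟩ := exists_loop_count (u := n x + c x) (a := -d x) (p := p) (by omega)
        (by have := hloop x; omega)
        (by have := hlow 0 (Nat.zero_le _) x; push_cast at this; omega)
      exact ⟨l, fun _ => ⟨by linarith, by linarith⟩⟩
    · exact ⟨0, fun h => absurd h hx⟩
  choose l hl using hl
  -- the number of rounds until the counter `x` gets small
  let N : Fin 2 → ℕ → ℤ := fun x t => l x + t * (m x * e x)
  have htL : ∀ t : ℕ, t ≤ 2 * M → p.factorial * t ≤ L := by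
    intro t ht
    rw [hL]
    nlinarith [Nat.factorial_pos p]
  have hNx : ∀ x, d x < 0 → ∀ t : ℕ,
      n x + (p.factorial * t : ℕ) * e x + c x + N x t * d x = n x + c x + l x * d x := by
    intro x hx t
    have := hm x hx
    simp only [N]
    push_cast
    rw [← hq]
    linear_combination -(t : ℤ) * e x * this
  have hNy : ∀ x, ∀ t : ℕ,
      n (1 - x) + (p.factorial * t : ℕ) * e (1 - x) + c (1 - x) + N x t * d (1 - x) =
        n (1 - x) + c (1 - x) + l x * d (1 - x) + t * B x := by
    intro x t
    simp only [N, B]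
    push_cast
    rw [← hq]
    ring
  have hN0 : ∀ x, d x < 0 → ∀ t : ℕ, t ≤ 2 * M → 0 ≤ N x t := by
    intro x hx t ht
    have h1 := hlow _ (htL t ht) x
    have h2 := hNx x hx t
    have h3 := (hl x hx).2
    by_contra hcon
    push Not at hcon
    nlinarith
  -- At the midpoint `M`, take the counter that gets small after the fewest rounds; the other one is
  -- still at least `p`.
  have hex : ∃ x, d x < 0 ∧
      (p : ℤ) ≤ n (1 - x) + c (1 - x) + l x * d (1 - x) + M * B x := by
    push Not at hpos
    obtain ⟨x, hx⟩ := hpos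
    have hM : M ≤ 2 * M := by omega
    have h0 := hN0 x hx M hM
    by_cases hy : d (1 - x) < 0
    · have hxy : ∀ a, d a < 0 → d (1 - a) < 0 → N a M ≤ N (1 - a) M → d a < 0 ∧
          (p : ℤ) ≤ n (1 - a) + c (1 - a) + l a * d (1 - a) + M * B a := by
        intro a ha ha' hle
        refine ⟨ha, ?_⟩
        have h1 := hNx (1 - a) ha' M
        have h2 := (hl (1 - a) ha').1
        rw [← hNy]
        nlinarith
      rcases le_total (N x M) (N (1 - x) M) with hle | hle
      · exact ⟨x, hxy x hx hy hle⟩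
      · refine ⟨1 - x, hxy (1 - x) hy ?_ ?_⟩
        · rwa [hinv]
        · rwa [hinv]
    · refine ⟨x, hx, ?_⟩
      rw [← hNy]
      have := hlow _ (htL M hM) (1 - x)
      push Not at hy
      nlinarith
  obtain ⟨x, hx, hxM⟩ := hex
  have hr0 : (((n x + c x + l x * d x).toNat : ℕ) : ℤ) = n x + c x + l x * d x :=
    Int.toNat_of_nonneg (by have := (hl x hx).1; omega)
  have hconf : ∀ t : ℕ, t ≤ 2 * M →
      (p : ℤ) ≤ n (1 - x) + c (1 - x) + l x * d (1 - x) + t * B x →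
      T.Halts (s', Function.update
        (fun _ => n (1 - x) + c (1 - x) + l x * d (1 - x) + t * B x) x
          ((n x + c x + l x * d x).toNat : ℤ)) (f (p.factorial * t)) := by
    intro t ht hY
    have hNn : (((N x t).toNat : ℕ) : ℤ) = N x t := Int.toNat_of_nonneg (hN0 x hx t ht)
    have h1 := hrun _ (htL t ht) (N x t).toNat ?_
    · convert h1 using 2
      funext z
      simp only [Pi.add_apply, Pi.smul_apply, smul_eq_mul, hNn]
      rcases hother x z with rfl | rfl
      · rw [Function.update_self, hr0, hNx _ hx]
      · rw [Function.update_of_ne (hne x), hNy]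
    · intro z
      rw [hNn]
      rcases hother x z with rfl | rfl
      · rw [hNx _ hx]
        exact (hl _ hx).1
      · rw [hNy]
        exact hY
  refine ⟨x, (n x + c x + l x * d x).toNat, n (1 - x) + c (1 - x) + l x * d (1 - x) + M * B x, ?_⟩
  have hr2 : (n x + c x + l x * d x).toNat < 2 * p := by
    have := (hl x hx).2
    omega
  have hfac : 1 ≤ p.factorial := Nat.factorial_pos p
  -- From the midpoint, move in the direction in which the other counter does not decrease.
  rcases le_total 0 (B x) with hB | hB
  · refine ⟨fun t => f (p.factorial * (M + t)), hr2, by omega, ?_, ⟨M, le_rfl, ?_⟩, ?_⟩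
    · intro t h h2 hM
      have := hf (p.factorial * (M + t)) (p.factorial * h) (by nlinarith)
        (le_trans (le_of_eq (by ring)) (htL (M + t + 2 * h) (by omega)))
      convert this using 4 <;> ring
    · have h1 := (hn _ (htL (M + M) (by omega))).2.2
      refine le_trans ?_ h1
      exact_mod_cast (by nlinarith : M ≤ p.factorial * (M + M))
    · intro t ht
      convert hconf (M + t) (by omega) ?_ using 3
      · funext _
        simp only [abs_of_nonneg hB]
        push_cast
        ring
      · push_cast
        nlinarith
  · refine ⟨fun t => f (p.factorial * (M - t)), hr2, by omega, ?_, ⟨0, Nat.zero_le _, ?_⟩, ?_⟩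
    · intro t h h2 hM
      have := hf (p.factorial * (M - (t + 2 * h))) (p.factorial * h) (by nlinarith)
        (le_trans (le_of_eq (by ring)) (htL (M - (t + 2 * h) + 2 * h) (by omega)))
      rw [add_comm]
      convert this using 4
      · rw [show M - t = M - (t + 2 * h) + 2 * h by omega]; ring
      · rw [show M - (t + h) = M - (t + 2 * h) + h by omega]; ring
    · have h1 := (hn _ (htL M (by omega))).2.2
      refine le_trans ?_ h1
      exact_mod_cast (by nlinarith : M ≤ p.factorial * M)
    · intro t ht
      have hcast : ((M - t : ℕ) : ℤ) = M - t := by omega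
      convert hconf (M - t) (by omega) ?_ using 3
      · funext _
        simp only [abs_of_nonpos hB, hcast]
        ring
      · rw [hcast]
        nlinarith

/-- There are no arbitrarily long linear families of halting configurations whose outputs are
nowhere affine. -/
theorem false_of_nowhereAffine_families [Finite S] (T : CounterSystem S) (s : S) (e : Fin 2 → ℤ)
    (h : ∀ L : ℕ, ∃ (n : Fin 2 → ℤ) (f : ℕ → ℤ), NowhereAffine L f ∧ ∀ t : ℕ, t ≤ L →
      (∀ x, (L : ℤ) ≤ n x + t * e x) ∧ T.Halts (s, n + (t : ℤ) • e) (f t) ∧ (t : ℤ) ≤ f t) :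
    False := by
  obtain ⟨p, hp1, hp⟩ := exists_iterate_idempotent T.fr
  obtain ⟨V, hV⟩ := exists_output_bound (T := T) (4 * (p : ℤ) * p + 10 * p)
  obtain ⟨β, hβ, hfam⟩ := exists_axis_family hp1 hp s e h
  set s' := T.fr^[p] s
  obtain ⟨x, hx⟩ := exists_frequently_of_finite hfam
  rcases (hβ x).eq_or_lt with hβ0 | hβ1
  · obtain ⟨M, hM, r, X, F, -, -, hF, -, hH⟩ := hx 4
    rw [← hβ0] at hH
    simp only [mul_zero] at hH
    have h2 := (hH 0 (by omega)).unique (hH 2 (by omega))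
    have h4 := (hH 0 (by omega)).unique (hH 4 (by omega))
    refine hF 0 2 le_rfl (by omega) ?_
    norm_num
    rw [← h2, ← h4]
    ring
  let P : ℕ → Fin (2 * p) × Fin (β x).toNat → Prop := fun L a =>
    ∃ M ≥ L, ∃ (X : ℤ) (F : ℕ → ℤ), X % β x = (a.2 : ℕ) ∧ 0 ≤ X ∧ NowhereAffine M F ∧
      (∃ t ≤ M, (M : ℤ) ≤ F t) ∧ ∀ t : ℕ, t ≤ M →
        T.Halts (s', Function.update (fun _ => X + t * β x) x ((a.1 : ℕ) : ℤ)) (F t)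
  have hP : ∀ L, ∃ a, P L a := by
    intro L
    obtain ⟨M, hM, r, X, F, hr, hX, hF⟩ := hx L
    have h1 := Int.emod_nonneg X hβ1.ne'
    have h2 := Int.emod_lt_of_pos X hβ1
    exact ⟨(⟨r, hr⟩, ⟨(X % β x).toNat, by omega⟩), M, hM, X, F,
      by simp only; omega, hX, hF⟩
  obtain ⟨⟨⟨r, hr⟩, ⟨ρ, hρ⟩⟩, hrρ⟩ := exists_frequently_of_finite hP
  -- A family long enough to contain an output above `V`.
  obtain ⟨L, hL, M, hM, X, F, hXρ, hX, -, ⟨t, ht, hFt⟩, hH⟩ := hrρ (V + 1).toNat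
  obtain ⟨k, hk⟩ := hH t ht
  have hne : x ≠ 1 - x := (by decide : ∀ x : Fin 2, x ≠ 1 - x) x
  have hother := (by decide : ∀ x z : Fin 2, z = x ∨ z = 1 - x) x
  set Y := X + t * β x with hY
  have hY0 : 0 ≤ Y := by positivity
  obtain ⟨D, A, hD, hDA⟩ := exists_affine_output hp1 hp hV k x (1 - x) s' _ (F t) hne
    (by
      intro z
      rcases hother z with rfl | rfl
      · simp
      · simpa [hne.symm] using hY0)
    (by simp only [Function.update_self]; omega) hk (by omega)
  obtain ⟨L₂, hL₂, M₂, hM₂, X₂, F₂, hX₂ρ, hX₂, hF₂, -, hH₂⟩ := hrρ (5 * D + Y.toNat)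
  obtain ⟨κ, hκ⟩ : β x ∣ X₂ - Y := by
    have h1 : β x ∣ X₂ - X := by
      apply Int.dvd_of_emod_eq_zero
      rw [Int.sub_emod, hX₂ρ, hXρ]
      simp
    have h2 : X₂ - Y = X₂ - X - β x * t := by rw [hY]; ring
    rw [h2]
    exact dvd_sub h1 (dvd_mul_right _ _)
  have hκY : -Y ≤ κ := by nlinarith
  -- The point of index `τ` in the second family lies `j * D` steps of `β x` beyond `Y`. The bound
  -- on `τ` leaves room for `4 * D` more indices.
  obtain ⟨j, τ, hjτ, hτ⟩ : ∃ j τ : ℕ, (j : ℤ) * D = κ + τ ∧ (τ : ℤ) ≤ D + Y := by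
    have hD' : (0 : ℤ) < D := by exact_mod_cast hD
    rcases le_or_gt 0 κ with hκ0 | hκ0
    · have h1 := Int.emod_add_mul_ediv κ D
      have h2 := Int.emod_nonneg κ hD'.ne'
      have h3 := Int.emod_lt_of_pos κ hD'
      have h4 : 0 ≤ κ / D := Int.ediv_nonneg hκ0 hD'.le
      refine ⟨(κ / D + 1).toNat, (D - κ % D).toNat, ?_, ?_⟩
      · rw [Int.toNat_of_nonneg (by omega), Int.toNat_of_nonneg (by omega)]
        linarith
      · omega
    · exact ⟨0, (-κ).toNat, by push_cast; omega, by omega⟩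
  have hval : ∀ i : ℕ, i ≤ 4 → F₂ (τ + i * D) = F t + ((j + i : ℕ) : ℤ) * β x * A := by
    intro i hi
    have hb : τ + i * D ≤ M₂ := by
      have : i * D ≤ 4 * D := Nat.mul_le_mul_right _ hi
      omega
    have h1 := hDA ((j + i) * (β x).toNat)
    have hβn : ((β x).toNat : ℤ) = β x := Int.toNat_of_nonneg (hβ x)
    refine (hH₂ _ hb).unique ?_
    convert h1 using 2
    · funext z
      rcases hother z with rfl | rfl
      · simp [hne]
      · simp only [Function.update_of_ne hne.symm, Pi.add_apply, Pi.single_eq_same]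
        push_cast
        rw [hβn]
        linear_combination hκ - β x * hjτ
    · push_cast
      rw [hβn]
  refine hF₂ τ (2 * D) (by omega) (by omega) ?_
  have e0 := hval 0 (by omega)
  have e2 := hval 2 (by omega)
  have e4 := hval 4 (by omega)
  rw [show τ + 2 * (2 * D) = τ + 4 * D by ring, e4, e2]
  rw [zero_mul, add_zero] at e0
  rw [e0]
  push_cast
  ring

end CounterSystem

/-! ### Input tapes absorbed into the state. -/

namespace TCMI

variable {b : ℕ}

/-- One move of `M` in line `q`, reading from a tape with content `r`; the line `none` is a dead
end. -/
def move (M : TCMI b) {R : Type} (pop : R → Option (InputSymbol b × R)) (q : M.Q) (r : R)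
    (z : Fin 2 → Bool) : Option (M.Q × R) × (Fin 2 → ℤ) :=
  match M.instr q with
  | .inc x next => (some (next, r), Pi.single x 1)
  | .dec x next => if z x then (none, 0) else (some (next, r), Pi.single x (-1))
  | .ifZero x l next => (some (if z x then l else next, r), 0)
  | .jump l => (some (l, r), 0)
  | .input l => ((pop r).map fun a => (l a.1, a.2), 0)
  | .halt => (some (q, r), 0)

/-- The machine `M` together with an input tape, as a machine without input. -/
def toSystem (M : TCMI b) {R : Type} (pop : R → Option (InputSymbol b × R)) :
    CounterSystem (Option (M.Q × R)) where
  nxt s z := s.elim none fun a => (M.move pop a.1 a.2 z).1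
  dlt s z := s.elim 0 fun a => (M.move pop a.1 a.2 z).2
  H := {s | ∃ q r, s = some (q, r) ∧ M.IsHalt q}
  abs_dlt_le := by
    rintro (_ | ⟨q, r⟩) z x
    · simp
    · have h1 : ∀ (y : Fin 2) (a : ℤ), |a| ≤ 1 → |(Pi.single y a : Fin 2 → ℤ) x| ≤ 1 := by
        intro y a ha
        rcases eq_or_ne x y with rfl | h
        · simpa using ha
        · simp [h]
      simp only [Option.elim_some, move]
      split <;> try simp
      · exact h1 _ _ (by simp)
      · split
        · simp
        · exact h1 _ _ (by simp)
  dlt_nonneg := by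
    rintro (_ | ⟨q, r⟩) z x hz
    · simp
    · simp only [Option.elim_some, move]
      split <;> try simp
      · rename_i y _ _
        rcases eq_or_ne x y with rfl | h
        · simp
        · simp [h]
      · rename_i y _ _
        split
        · simp
        · rcases eq_or_ne x y with rfl | h
          · contradiction
          · simp [h]
  nxt_halt := by
    rintro _ z ⟨q, r, rfl, h⟩
    unfold IsHalt at h
    simp [move, h]
  dlt_halt := by
    rintro _ z ⟨q, r, rfl, h⟩
    unfold IsHalt at h
    simp [move, h]

/-- The configuration of `M.toSystem pop` with tape content `r` that corresponds to `c`. -/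
def embed {M : TCMI b} {R : Type} (c : M.Config) (r : R) : Option (M.Q × R) × (Fin 2 → ℤ) :=
  (some (c.state, r), fun x => (c.counter x : ℤ))

theorem step_embed_of_step {M : TCMI b} {R : Type} {pop : R → Option (InputSymbol b × R)}
    {c c' : M.Config} (h : M.step c = some c') (r : R) :
    (M.toSystem pop).step (embed c r) = embed c' r := by
  obtain ⟨q, n⟩ := c
  rcases hi : M.instr q with ⟨x, l⟩ | ⟨x, l⟩ | ⟨x, l, l'⟩ | l | l | _ <;>
    simp only [TCMI.step, hi, reduceCtorEq] at h <;>
    simp only [CounterSystem.step, toSystem, embed, Option.elim_some, move, hi]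
  · obtain rfl := Option.some.inj h
    simp only [Prod.mk.injEq, true_and]
    funext y
    rcases eq_or_ne y x with rfl | hy
    · simp
    · simp [hy]
  · split at h
    · simp at h
    · rename_i hx
      obtain rfl := Option.some.inj h
      simp only [Nat.cast_eq_zero, hx, decide_false, Bool.false_eq_true, if_false,
        Prod.mk.injEq, true_and]
      funext y
      rcases eq_or_ne y x with rfl | hy
      · simp only [Pi.add_apply, Pi.single_eq_same, Function.update_self]
        omega
      · simp [hy]
  · obtain rfl := Option.some.inj h
    simp
  · obtain rfl := Option.some.inj h
    simp

theorem step_embed_of_input {M : TCMI b} {R : Type} {pop : R → Option (InputSymbol b × R)}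
    {c : M.Config} {l : InputSymbol b → M.Q} (h : M.instr c.state = .input l) {r r' : R}
    {a : InputSymbol b} (hr : pop r = some (a, r')) :
    (M.toSystem pop).step (embed c r) = embed ⟨l a, c.counter⟩ r' := by
  simp [CounterSystem.step, toSystem, embed, move, h, hr]

theorem step_none {M : TCMI b} {R : Type} {pop : R → Option (InputSymbol b × R)}
    (n : Fin 2 → ℤ) : (M.toSystem pop).step (none, n) = (none, n) := by
  simp [CounterSystem.step, toSystem]

/-- Stated for any tape type with a reading `word`, to serve both arbitrary lists and the finite
tape `1⋄`, which keeps the state set finite. -/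
theorem Reaches.exists_iterate_embed {M : TCMI b} {R : Type} {pop : R → Option (InputSymbol b × R)}
    {word : R → List (InputSymbol b)} (h0 : ∀ r, pop r = none → word r = [])
    (h1 : ∀ r a r', pop r = some (a, r') → word r = a :: word r') {c c' : M.Config}
    {I : List (InputSymbol b)} (h : M.Reaches c I c') :
    ∀ r, word r = I →
      ∃ k r', word r' = [] ∧ (M.toSystem pop).step^[k] (embed c r) = embed c' r' := by
  induction h with
  | refl c => exact fun r hr => ⟨0, r, hr, rfl⟩
  | step hs _ ih =>
    intro r hr
    obtain ⟨k, r', hr', hk⟩ := ih r hr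
    exact ⟨k + 1, r', hr', by rw [Function.iterate_succ_apply, step_embed_of_step hs, hk]⟩
  | read hs _ ih =>
    intro r hr
    rcases hp : pop r with _ | ⟨a', r₁⟩
    · rw [h0 r hp] at hr
      cases hr
    · rw [h1 r a' r₁ hp] at hr
      obtain ⟨rfl, hr₁⟩ := List.cons.inj hr
      obtain ⟨k, r', hr', hk⟩ := ih r₁ hr₁
      exact ⟨k + 1, r', hr', by rw [Function.iterate_succ_apply, step_embed_of_input hs hp, hk]⟩

/-- The tape given by a list of symbols. -/
def popList : List (InputSymbol b) → Option (InputSymbol b × List (InputSymbol b))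
  | [] => none
  | a :: I => some (a, I)

theorem reaches_of_iterate_embed {M : TCMI b} (k : ℕ) :
    ∀ (c : M.Config) (I r : List (InputSymbol b)) (q : M.Q) (n : Fin 2 → ℤ),
      (M.toSystem popList).step^[k] (embed c I) = (some (q, r), n) →
      ∃ (u : List (InputSymbol b)) (n' : Fin 2 → ℕ), I = u ++ r ∧ n = (fun x => (n' x : ℤ)) ∧
        M.Reaches c u ⟨q, n'⟩ := by
  induction k with
  | zero =>
    intro c I r q n h
    simp only [Function.iterate_zero, id_eq, embed, Prod.mk.injEq, Option.some.injEq] at h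
    obtain ⟨⟨rfl, rfl⟩, rfl⟩ := h
    exact ⟨[], c.counter, rfl, rfl, .refl _⟩
  | succ k ih =>
    intro c I r q n h
    rw [Function.iterate_succ_apply] at h
    rcases hs : M.step c with _ | c'
    · have hnone : ∀ m, (M.toSystem popList).step (embed c I) ≠ (none, m) := by
        intro m hm
        rw [hm, Function.iterate_fixed (step_none m)] at h
        simp at h
      rcases hi : M.instr c.state with ⟨x, l⟩ | ⟨x, l⟩ | ⟨x, l, l'⟩ | l | l | _
      · simp [TCMI.step, hi] at hs
      · simp only [TCMI.step, hi] at hs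
        split at hs
        · rename_i hx
          exact absurd (by simp [CounterSystem.step, toSystem, embed, move, hi, hx])
            (hnone (fun x => (c.counter x : ℤ)))
        · simp at hs
      · simp [TCMI.step, hi] at hs
      · simp [TCMI.step, hi] at hs
      · rcases I with _ | ⟨a, I⟩
        · exact absurd (by simp [CounterSystem.step, toSystem, embed, move, hi, popList])
            (hnone (fun x => (c.counter x : ℤ)))
        · rw [step_embed_of_input hi (r' := I) (a := a) rfl] at h
          obtain ⟨u, n', rfl, hn, hu⟩ := ih _ _ _ _ _ h
          exact ⟨a :: u, n', rfl, hn, .read hi hu⟩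
      · have hH : (embed c I).1 ∈ (M.toSystem popList).H := ⟨c.state, I, rfl, hi⟩
        rw [CounterSystem.step_of_mem hH] at h
        exact ih _ _ _ _ _ h
    · rw [step_embed_of_step hs] at h
      obtain ⟨u, n', rfl, hn, hu⟩ := ih _ _ _ _ _ h
      exact ⟨u, n', rfl, hn, .step hs hu⟩

theorem Reaches.trans {M : TCMI b} {c c' c'' : M.Config} {I J : List (InputSymbol b)}
    (h : M.Reaches c I c') (h' : M.Reaches c' J c'') : M.Reaches c (I ++ J) c'' := by
  induction h with
  | refl => exact h'
  | step hs _ ih => exact .step hs (ih h')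
  | read hs _ ih => exact .read hs (ih h')

theorem step_eq_none_of_input {M : TCMI b} {c : M.Config} {l : InputSymbol b → M.Q}
    (h : M.instr c.state = .input l) : M.step c = none := by
  simp [TCMI.step, h]

theorem step_eq_none_of_isHalt {M : TCMI b} {c : M.Config}
    (h : M.IsHalt c.state) : M.step c = none := by
  unfold IsHalt at h
  simp [TCMI.step, h]

/-- A run that ends in a halting state passes through every configuration reached on a prefix of
the input. -/
theorem Reaches.of_append {M : TCMI b} {c c' c'' : M.Config} {I J : List (InputSymbol b)}
    (h : M.Reaches c I c') (h' : M.Reaches c (I ++ J) c'') (hc : M.IsHalt c''.state) :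
    M.Reaches c' J c'' := by
  induction h with
  | refl => exact h'
  | step hs _ ih =>
    generalize hK : _ ++ J = K at h' ih
    cases h' with
    | refl => simp [step_eq_none_of_isHalt hc] at hs
    | step hs' h' =>
      rw [hs] at hs'
      obtain rfl := Option.some.inj hs'
      exact ih h'
    | read hs' => simp [step_eq_none_of_input hs'] at hs
  | read hs _ ih =>
    rw [List.cons_append] at h'
    cases h' with
    | step hs' => simp [step_eq_none_of_input hs] at hs'
    | read hs' h' =>
      rw [hs] at hs'
      cases hs'
      exact ih h'

/-- A run on a nonempty continuation of `I` waits for input after `I`. -/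
theorem Reaches.exists_wait {M : TCMI b} {c c'' : M.Config} {I J : List (InputSymbol b)}
    {a : InputSymbol b} (h : M.Reaches c (I ++ a :: J) c'') :
    ∃ c', M.Reaches c I c' ∧ M.IsWait c'.state := by
  generalize hK : I ++ a :: J = K at h
  induction h generalizing I with
  | refl => simp at hK
  | step hs _ ih =>
    obtain ⟨c', h1, h2⟩ := ih hK
    exact ⟨c', .step hs h1, h2⟩
  | @read c _ l a' K' hs _ ih =>
    rcases I with _ | ⟨a'', I⟩
    · exact ⟨c, .refl c, l, hs⟩
    · obtain ⟨rfl, rfl⟩ := List.cons.inj hK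
      obtain ⟨c', h1, h2⟩ := ih rfl
      exact ⟨c', .read hs h1, h2⟩

end TCMI

/-! ### Input cycles, and the bound on one counter at waits. -/

namespace TCMI

variable {b : ℕ}

theorem iterate_fr_none {M : TCMI b} {R : Type} {pop : R → Option (InputSymbol b × R)} (k : ℕ) :
    (M.toSystem pop).fr^[k] none = none :=
  Function.iterate_fixed (by simp [CounterSystem.fr, toSystem]) k

/-- If `M` waits with large counters, then shortly before it went through a cycle of program lines
that consumes input and does not depend on the exact values of the counters. -/
theorem exists_cycle_of_large {M : TCMI b} {I : List (InputSymbol b)} {c : M.Config} {B : ℕ}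
    (h : M.Reaches M.init I c) (hw : M.IsWait c.state)
    (hB : ∀ x, B + 2 * Nat.card M.Q ≤ c.counter x) :
    ∃ (q : M.Q) (e : Fin 2 → ℤ) (n : Fin 2 → ℕ) (u s w : List (InputSymbol b)),
      (∀ x, |e x| ≤ Nat.card M.Q) ∧ I = u ++ s ++ w ∧ s ≠ [] ∧ M.Reaches M.init u ⟨q, n⟩ ∧
      (∀ x, B ≤ n x) ∧
      ∀ n' : Fin 2 → ℕ, (∀ x, Nat.card M.Q ≤ n' x) →
        ∃ n'' : Fin 2 → ℕ, (∀ x, (n'' x : ℤ) = n' x + e x) ∧ M.Reaches ⟨q, n'⟩ s ⟨q, n''⟩ := by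
  have := M.finite_Q
  set K := Nat.card M.Q with hK
  set T := M.toSystem (popList (b := b)) with hT
  obtain ⟨k, r, hr, hk⟩ := h.exists_iterate_embed (pop := popList) (word := id)
    (by rintro (_ | ⟨a, r⟩) h <;> simp_all [popList])
    (by rintro (_ | ⟨a, r⟩) a' r' h <;> simp_all [popList]) I rfl
  obtain rfl : r = [] := hr
  rw [← hT] at hk
  have hKk : K ≤ k := by
    have h1 := CounterSystem.abs_iterate_step_sub_le (T := T) (embed M.init I) k 0
    rw [hk] at h1
    have h2 := hB 0
    simp only [embed, init] at h1
    rw [abs_le] at h1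
    omega
  let cf : ℕ → Option (M.Q × List (InputSymbol b)) × (Fin 2 → ℤ) :=
    fun i => T.step^[k - K + i] (embed M.init I)
  have hcf : ∀ i j, i ≤ j → T.step^[j - i] (cf i) = cf j := by
    intro i j hij
    simp only [cf]
    rw [← Function.iterate_add_apply, show j - i + (k - K + i) = k - K + j by omega]
  have hcfK : cf K = embed c [] := by
    simp only [cf]
    rw [Nat.sub_add_cancel hKk, hk]
  have hsome : ∀ i, i ≤ K → ∃ q r n, cf i = (some (q, r), n) := by
    intro i hi
    rcases hci : cf i with ⟨_ | ⟨q, r⟩, n⟩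
    · have h1 := hcf i K hi
      rw [hci, Function.iterate_fixed (step_none n), hcfK] at h1
      simp [embed] at h1
    · exact ⟨q, r, n, rfl⟩
  have hlarge : ∀ i, i ≤ K → ∀ x, (B : ℤ) + K ≤ (cf i).2 x := by
    intro i hi x
    have h1 := CounterSystem.abs_iterate_step_sub_le (T := T) (cf i) (K - i) x
    rw [hcf i K hi, hcfK, abs_le] at h1
    have h2 := hB x
    simp only [embed] at h1
    omega
  choose Q R N hQRN using hsome
  obtain ⟨i, j, hij, hQ⟩ : ∃ i j : Fin (K + 1), i ≠ j ∧
      Q i (Nat.lt_succ_iff.1 i.2) = Q j (Nat.lt_succ_iff.1 j.2) := by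
    by_contra hcon
    push Not at hcon
    have hinj : Function.Injective fun i : Fin (K + 1) => Q i (Nat.lt_succ_iff.1 i.2) :=
      fun i j hh => by_contra fun hne => hcon i j hne hh
    have := Nat.card_le_card_of_injective _ hinj
    rw [Nat.card_eq_fintype_card, Fintype.card_fin] at this
    omega
  wlog hlt : i < j generalizing i j
  · exact this j i hij.symm hQ.symm (lt_of_le_of_ne (not_lt.1 hlt) hij.symm)
  obtain ⟨i, hi⟩ := i
  obtain ⟨j, hj⟩ := j
  replace hlt : i < j := hlt
  have hi' := Nat.lt_succ_iff.1 hi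
  have hj' := Nat.lt_succ_iff.1 hj
  have hci := hQRN i hi'
  have hcj := hQRN j hj'
  simp only at hQ
  rw [← hQ] at hcj
  set q := Q i hi'
  have hli := hlarge i hi'
  rw [hci] at hli
  simp only at hli
  obtain ⟨u, n, hu, hn, hun⟩ := reaches_of_iterate_embed _ _ _ _ _ _ hci
  have hfree : ∀ m, m ≤ K → T.step^[m] (some (q, R i hi'), N i hi') =
      (T.fr^[m] (some (q, R i hi')), N i hi' + T.disp m (some (q, R i hi'))) := by
    intro m hm
    refine CounterSystem.iterate_step_free m _ _ fun x => ?_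
    have := hli x
    omega
  have hfrj : T.fr^[j - i] (some (q, R i hi')) = some (q, R j hj') := by
    have h1 := hcf i j hlt.le
    rw [hci, hcj, hfree _ (by omega)] at h1
    exact congrArg Prod.fst h1
  have hfrK : T.fr^[K - i] (some (q, R i hi')) = some (c.state, []) := by
    have h1 := hcf i K hi'
    rw [hci, hcfK, hfree _ (by omega)] at h1
    exact congrArg Prod.fst h1
  -- While no counter vanishes, the moves depend only on line and tape, so any large counters give
  -- the same cycle.
  have hcyc : ∀ n' : Fin 2 → ℕ, (∀ x, K ≤ n' x) →
      ∃ (s : List (InputSymbol b)) (n'' : Fin 2 → ℕ), R i hi' = s ++ R j hj' ∧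
        (∀ x, (n'' x : ℤ) = n' x + T.disp (j - i) (some (q, R i hi')) x) ∧
        M.Reaches ⟨q, n'⟩ s ⟨q, n''⟩ := by
    intro n' hn'
    have h1 : T.step^[j - i] (embed ⟨q, n'⟩ (R i hi')) = _ :=
      CounterSystem.iterate_step_free (j - i) _ _ fun x => by have := hn' x; simp only; omega
    simp only [] at h1
    rw [hfrj] at h1
    obtain ⟨s, n'', hs, hn'', hr⟩ := reaches_of_iterate_embed _ _ _ _ _ _ h1
    exact ⟨s, n'', hs, fun x => (congrFun hn'' x).symm, hr⟩
  obtain ⟨s, -, hs, -, -⟩ := hcyc (fun _ => K) fun _ => le_rfl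
  refine ⟨q, T.disp (j - i) (some (q, R i hi')), n, u, s, R j hj', fun x => ?_, ?_, ?_, hun, ?_, ?_⟩
  · refine (CounterSystem.abs_disp_le _ _ _).trans ?_
    omega
  · rw [hu, hs, List.append_assoc]
  · rintro rfl
    rw [List.nil_append] at hs
    rw [← hs] at hfrj
    have h1 : T.fr^[j - i] (some (c.state, [])) = some (c.state, []) := by
      rw [← hfrK, ← Function.iterate_add_apply, add_comm, Function.iterate_add_apply, hfrj]
    obtain ⟨l, hl⟩ := hw
    have h2 : T.fr (some (c.state, [])) = none := by
      simp [T, CounterSystem.fr, toSystem, move, hl, popList]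
    rw [show j - i = j - i - 1 + 1 by omega, Function.iterate_succ_apply, h2, iterate_fr_none] at h1
    simp at h1
  · intro x
    have h1 := hli x
    rw [hn] at h1
    simp only at h1
    omega
  · intro n' hn'
    obtain ⟨s', n'', hs', hn'', hr⟩ := hcyc n' hn'
    rw [hs] at hs'
    obtain rfl := List.append_cancel_right hs'
    exact ⟨n'', hn'', hr⟩

/-- Running through a cycle `t` times. -/
theorem reaches_cycle {M : TCMI b} {q : M.Q} {e : Fin 2 → ℤ} {s : List (InputSymbol b)} {K : ℕ}
    (he : ∀ x, |e x| ≤ K)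
    (hs : ∀ n' : Fin 2 → ℕ, (∀ x, K ≤ n' x) →
      ∃ n'' : Fin 2 → ℕ, (∀ x, (n'' x : ℤ) = n' x + e x) ∧ M.Reaches ⟨q, n'⟩ s ⟨q, n''⟩)
    (t : ℕ) (n : Fin 2 → ℕ) (hn : ∀ x, K * (t + 1) ≤ n x) :
    ∃ n' : Fin 2 → ℕ, (∀ x, (n' x : ℤ) = n x + t * e x) ∧
      M.Reaches ⟨q, n⟩ (List.replicate t s).flatten ⟨q, n'⟩ := by
  induction t generalizing n with
  | zero => exact ⟨n, by simp, by simpa using .refl _⟩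
  | succ t ih =>
    obtain ⟨n₁, hn₁, h₁⟩ := hs n fun x => by have := hn x; nlinarith
    obtain ⟨n₂, hn₂, h₂⟩ := ih n₁ fun x => by
      have h1 := hn x
      have h2 := hn₁ x
      have h3 := abs_le.1 (he x)
      zify at h1 ⊢
      rw [h2]
      linarith
    refine ⟨n₂, fun x => ?_, ?_⟩
    · rw [hn₂, hn₁]
      push_cast
      ring
    · rw [List.replicate_succ, List.flatten_cons]
      exact h₁.trans h₂

/-- The tape holding the digit `1` and the stop marker. -/
def popOneEnd (hb : 1 < b) : Fin 3 → Option (InputSymbol b × Fin 3)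
  | 0 => some (.digit ⟨1, hb⟩, 1)
  | 1 => some (.endMarker, 2)
  | 2 => none

theorem halts_of_reaches_one_end {M : TCMI b} (hb : 1 < b) {q : M.Q} {n : Fin 2 → ℕ} {c : M.Config}
    (h : M.Reaches ⟨q, n⟩ [.digit ⟨1, hb⟩, .endMarker] c) (hc : M.IsHalt c.state) :
    (M.toSystem (popOneEnd hb)).Halts (some (q, 0), fun x => (n x : ℤ)) (c.counter 0) := by
  obtain ⟨k, r, -, hk⟩ := h.exists_iterate_embed (pop := popOneEnd hb)
    (word := ![[.digit ⟨1, hb⟩, .endMarker], [.endMarker], []])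
    (by
      intro r h
      fin_cases r
      · simp [popOneEnd] at h
      · simp [popOneEnd] at h
      · rfl)
    (by
      intro r a r' h
      fin_cases r
      · obtain ⟨rfl, rfl⟩ := Prod.mk.inj (Option.some.inj h)
        rfl
      · obtain ⟨rfl, rfl⟩ := Prod.mk.inj (Option.some.inj h)
        rfl
      · simp [popOneEnd] at h) 0 rfl
  refine ⟨k, ?_⟩
  change (((M.toSystem (popOneEnd hb)).step^[k] (embed ⟨q, n⟩ 0)).1 ∈ _ ∧
    ((M.toSystem (popOneEnd hb)).step^[k] (embed ⟨q, n⟩ 0)).2 0 = _)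
  rw [hk]
  exact ⟨⟨c.state, r, rfl, hc⟩, rfl⟩

/-- The leading 1 fixes the order of magnitude even if all other digits are zero. -/
theorem ofDigits_append_one (hb : 1 < b) (W : List (Fin b)) :
    b ^ W.length ≤ Nat.ofDigits b ((W ++ [(⟨1, hb⟩ : Fin b)]).map Fin.val) ∧
      Nat.ofDigits b ((W ++ [(⟨1, hb⟩ : Fin b)]).map Fin.val) < 2 * b ^ W.length := by
  have h1 : Nat.ofDigits b (W.map Fin.val) < b ^ (W.map Fin.val).length := by
    refine Nat.ofDigits_lt_base_pow_length hb ?_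
    intro x hx
    obtain ⟨d, -, rfl⟩ := List.mem_map.1 hx
    exact d.2
  rw [List.length_map] at h1
  rw [List.map_append, Nat.ofDigits_append]
  simp only [List.length_map, List.map_cons, List.map_nil, Nat.ofDigits_singleton]
  constructor <;> omega

/-- The values of `U s ⋯ s 1` grow exponentially in the number of repetitions of `s`. -/
theorem nowhereAffine_ofDigits (hb : 1 < b) (U s : List (Fin b)) (hs : s ≠ []) (L : ℕ) :
    NowhereAffine L fun t => ((Nat.ofDigits b
      ((U ++ (List.replicate t s).flatten ++ [(⟨1, hb⟩ : Fin b)]).map Fin.val) : ℕ) : ℤ) := by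
  intro t h h2 _
  have hlen : ∀ t, (U ++ (List.replicate t s).flatten).length = U.length + t * s.length := by
    intro t
    simp
  have h0 := ofDigits_append_one hb (U ++ (List.replicate (t + 2 * h) s).flatten)
  have h1 := ofDigits_append_one hb (U ++ (List.replicate (t + h) s).flatten)
  rw [hlen] at h0 h1
  set X := b ^ (U.length + t * s.length)
  set y := b ^ (h * s.length)
  have hs1 : 1 ≤ s.length := List.length_pos_iff.2 hs
  -- Values are known up to a factor 2, so a growth factor of 4 is needed; this is why differences
  -- are at least 2.
  have hy : 4 ≤ y := calc
    4 = 2 ^ 2 := by norm_num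
    _ ≤ b ^ 2 := Nat.pow_le_pow_left hb 2
    _ ≤ b ^ (h * s.length) := Nat.pow_le_pow_right (by omega) (by nlinarith)
  have e0 : b ^ (U.length + (t + 2 * h) * s.length) = X * (y * y) := by
    simp only [X, y]
    ring
  have e1 : b ^ (U.length + (t + h) * s.length) = X * y := by
    simp only [X, y]
    ring
  rw [e0] at h0
  rw [e1] at h1
  have h3 : 4 * (X * y) ≤ X * (y * y) := by nlinarith [Nat.zero_le (X * y)]
  have h4 := h0.1
  have h5 := h1.2
  simp only [ne_eq]
  norm_cast
  omega

theorem le_ofDigits (hb : 1 < b) (U s : List (Fin b)) (hs : s ≠ []) (t : ℕ) :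
    t ≤ Nat.ofDigits b
      ((U ++ (List.replicate t s).flatten ++ [(⟨1, hb⟩ : Fin b)]).map Fin.val) := by
  have hs1 : 1 ≤ s.length := List.length_pos_iff.2 hs
  refine le_trans ?_ (ofDigits_append_one hb _).1
  refine (Nat.lt_pow_self hb).le.trans (Nat.pow_le_pow_right (by omega) ?_)
  simp only [List.length_append, List.length_flatten, List.map_replicate, List.sum_replicate,
    smul_eq_mul]
  nlinarith

/-- If `M` counts, then one of its counters is bounded whenever it waits for input. -/
theorem Counts.exists_bound {M : TCMI b} (hb : 2 ≤ b) (hM : M.Counts) :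
    ∃ C, ∀ (I : List (Fin b)) (c : M.Config), M.Reaches M.init (I.map InputSymbol.digit) c →
      M.IsWait c.state → c.counter 0 ≤ C ∨ c.counter 1 ≤ C := by
  by_contra hcon
  push Not at hcon
  have := M.finite_Q
  have hb1 : 1 < b := hb
  set K := Nat.card M.Q with hK
  let T := M.toSystem (popOneEnd hb1)
  let P : ℕ → M.Q × Set.Icc (fun _ => -K : Fin 2 → ℤ) (fun _ => K) → Prop := fun L a =>
    ∃ (n : Fin 2 → ℤ) (f : ℕ → ℤ), NowhereAffine L f ∧ ∀ t : ℕ, t ≤ L →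
      (∀ x, (L : ℤ) ≤ n x + t * a.2.1 x) ∧
      T.Halts (some (a.1, 0), n + (t : ℤ) • a.2.1) (f t) ∧ (t : ℤ) ≤ f t
  have hP : ∀ L, ∃ a, P L a := by
    intro L
    -- `K * (L + 1)` pays for up to `L` cycles and leaves both counters at least `L`.
    obtain ⟨I, c, hI, hw, h0, h1⟩ := hcon (L + K * (L + 1) + 2 * K)
    obtain ⟨q, e, n, u, s, w, he, hIe, hs, hu, hn, hcyc⟩ :=
      exists_cycle_of_large (B := L + K * (L + 1)) hI hw (by
        intro x
        fin_cases x
        · exact h0.le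
        · exact h1.le)
    rw [← hK] at he hcyc
    obtain ⟨us, W, -, hus, -⟩ := List.map_eq_append_iff.1 hIe
    obtain ⟨U, Sg, -, rfl, rfl⟩ := List.map_eq_append_iff.1 hus
    have hSg : Sg ≠ [] := by simpa using hs
    refine ⟨(q, ⟨e, fun x => (abs_le.1 (he x)).1, fun x => (abs_le.1 (he x)).2⟩),
      fun x => (n x : ℤ), _, nowhereAffine_ofDigits hb1 U Sg hSg L,
      fun t ht => ⟨fun x => ?_, ?_, ?_⟩⟩
    · have h2 := abs_le.1 (he x)
      have h3 := hn x
      have h4 : -((K : ℤ) * L) ≤ t * e x := by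
        have : (t : ℤ) ≤ L := by exact_mod_cast ht
        nlinarith
      zify at h3
      simp only
      linarith
    · obtain ⟨n', hn', hr⟩ := reaches_cycle he hcyc t n fun x => by
        have h3 := hn x
        have : K * (t + 1) ≤ K * (L + 1) := Nat.mul_le_mul_left _ (by omega)
        omega
      obtain ⟨c', hc', hH, hv, -⟩ := hM (U ++ (List.replicate t Sg).flatten ++ [(⟨1, hb1⟩ : Fin b)])
      have hpre := hu.trans hr
      have hsplit : (U ++ (List.replicate t Sg).flatten ++ [(⟨1, hb1⟩ : Fin b)]).map
          InputSymbol.digit ++ [InputSymbol.endMarker] = U.map InputSymbol.digit ++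
            (List.replicate t (Sg.map InputSymbol.digit)).flatten ++
              [InputSymbol.digit ⟨1, hb1⟩, InputSymbol.endMarker] := by
        simp [List.map_flatten]
      rw [hsplit] at hc'
      have h5 := halts_of_reaches_one_end hb1 (hpre.of_append hc' hH) hH
      rw [hv] at h5
      convert h5 using 2
      funext x
      simp [hn' x]
    · exact_mod_cast le_ofDigits hb1 U Sg hSg t
  obtain ⟨⟨q, e, he⟩, hqe⟩ := exists_frequently_of_finite hP
  refine T.false_of_nowhereAffine_families (some (q, 0)) e fun L => ?_
  obtain ⟨L', hL', n, f, hf, hn⟩ := hqe L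
  refine ⟨n, f, fun t h h2 hL => hf t h h2 (hL.trans hL'), fun t ht => ?_⟩
  obtain ⟨h1, h2, h3⟩ := hn t (ht.trans hL')
  exact ⟨fun x => le_trans (by exact_mod_cast hL') (h1 x), h2, h3⟩

end TCMI

/-! ### The machine that empties a small counter before waiting. -/

namespace TCMI

variable {b : ℕ}

/-- What the machine that empties a counter before waiting is doing: it tests a counter, decrements
it, undoes the decrements, waits, or restores the counter after having read a symbol. -/
inductive Mode : Type
  | test | down | back | hold | up

instance : Finite Mode := by
  refine Finite.of_injective
    (fun m : Mode => (match m with | .test => 0 | .down => 1 | .back => 2 | .hold => 3 | .up => 4 :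
      Fin 5)) ?_
  intro a a' h
  cases a <;> cases a' <;> first | rfl | simp at h

/-- An instruction of `M` other than an input command, as an instruction of another machine. -/
def mapInstr {Q Q' : Type} (f : Q → Q') (wait : Q') : TCMIInstr b Q → TCMIInstr b Q'
  | .inc x next => .inc x (f next)
  | .dec x next => .dec x (f next)
  | .ifZero x l next => .ifZero x (f l) (f next)
  | .jump l => .jump (f l)
  | .input _ => .jump wait
  | .halt => .halt

/-- The line at which control continues after reading `a` in line `q`. -/
def afterRead (M : TCMI b) (q : M.Q) (a : InputSymbol b) : M.Q :=
  match M.instr q with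
  | .input l => l a
  | _ => q

/-- The machine that simulates `M`, but before waiting empties a counter with value at most `C`, if
there is one, keeping its value in the state. -/
def emptying (M : TCMI b) (C : ℕ) : TCMI b where
  Q := M.Q ⊕ (Mode × Fin 2 × M.Q × Fin (C + 1))
  finite_Q := by have := M.finite_Q; infer_instance
  q₀ := .inl M.q₀
  instr
    | .inl q => mapInstr .inl (.inr (.test, 0, q, 0)) (M.instr q)
    | .inr (.test, x, q, m) => .ifZero x (.inr (.hold, x, q, m))
        (if m.1 < C then .inr (.down, x, q, m)
          -- If counter 1 is too large as well, the machine waits without emptying it, so the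
          -- simulation is faithful for every `C`.
          else if x = 0 then .inr (.back, x, q, m) else .inr (.hold, x, q, m))
    | .inr (.down, x, q, m) => .dec x
        (if h : m.1 < C then .inr (.test, x, q, ⟨m.1 + 1, by omega⟩) else .inl q)
    | .inr (.back, x, q, m) => if m.1 = 0 then .jump (.inr (.test, 1, q, 0))
        else .inc x (.inr (.back, x, q, ⟨m.1 - 1, by omega⟩))
    | .inr (.hold, x, q, m) => .input fun a => .inr (.up, x, M.afterRead q a, m)
    | .inr (.up, x, q, m) => if m.1 = 0 then .jump (.inl q)
        else .inc x (.inr (.up, x, q, ⟨m.1 - 1, by omega⟩))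

variable {M : TCMI b} {C : ℕ}

theorem emptying_reaches_up (x : Fin 2) (q : M.Q) (m : ℕ) (hm : m < C + 1) (n : Fin 2 → ℕ) :
    (M.emptying C).Reaches ⟨Sum.inr (.up, x, q, ⟨m, hm⟩), n⟩ []
      ⟨Sum.inl q, Function.update n x (n x + m)⟩ := by
  induction m generalizing n with
  | zero =>
    refine .step (M := M.emptying C) (c' := ⟨Sum.inl q, n⟩) (by simp [TCMI.step, emptying]) ?_
    simpa using .refl _
  | succ m ih =>
    refine .step (M := M.emptying C)
      (c' := ⟨Sum.inr (.up, x, q, ⟨m, by omega⟩), Function.update n x (n x + 1)⟩)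
      (by simp [TCMI.step, emptying]) ?_
    convert ih (by omega) (Function.update n x (n x + 1)) using 2
    simp
    congr 1
    omega

theorem emptying_reaches_back (q : M.Q) (m : ℕ) (hm : m < C + 1) (n : Fin 2 → ℕ) :
    (M.emptying C).Reaches ⟨Sum.inr (.back, 0, q, ⟨m, hm⟩), n⟩ []
      ⟨Sum.inr (.test, 1, q, 0), Function.update n 0 (n 0 + m)⟩ := by
  induction m generalizing n with
  | zero =>
    refine .step (M := M.emptying C)
      (c' := ⟨Sum.inr (.test, 1, q, 0), n⟩) (by simp [TCMI.step, emptying]) ?_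
    simpa using .refl _
  | succ m ih =>
    refine .step (M := M.emptying C)
      (c' := ⟨Sum.inr (.back, 0, q, ⟨m, by omega⟩), Function.update n 0 (n 0 + 1)⟩)
      (by simp [TCMI.step, emptying]) ?_
    convert ih (by omega) (Function.update n 0 (n 0 + 1)) using 2
    simp
    congr 1
    omega

/-- Testing a counter that is small enough empties it. -/
theorem emptying_reaches_hold (x : Fin 2) (q : M.Q) (k : ℕ) :
    ∀ (m : ℕ) (hm : m + k < C + 1) (n : Fin 2 → ℕ), n x = k →
    (M.emptying C).Reaches ⟨Sum.inr (.test, x, q, ⟨m, by omega⟩), n⟩ []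
      ⟨Sum.inr (.hold, x, q, ⟨m + k, hm⟩), Function.update n x 0⟩ := by
  induction k with
  | zero =>
    intro m hm n hn
    refine .step (M := M.emptying C)
      (c' := ⟨Sum.inr (.hold, x, q, ⟨m, by omega⟩), n⟩) (by simp [TCMI.step, emptying, hn]) ?_
    have h0 : Function.update n x 0 = n := by rw [← hn, Function.update_eq_self]
    rw [h0]
    exact .refl _
  | succ k ih =>
    intro m hm n hn
    have hmC : m < C := by omega
    refine .step (M := M.emptying C)
      (c' := ⟨Sum.inr (.down, x, q, ⟨m, by omega⟩), n⟩)
      (by simp [TCMI.step, emptying, hn, hmC]) ?_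
    refine .step (M := M.emptying C)
      (c' := ⟨Sum.inr (.test, x, q, ⟨m + 1, by omega⟩), Function.update n x k⟩)
      (by simp [TCMI.step, emptying, hn, hmC]) ?_
    convert ih (m + 1) (by omega) (Function.update n x k) (by simp) using 2
    have hmk : (⟨m + (k + 1), hm⟩ : Fin (C + 1)) = ⟨m + 1 + k, by omega⟩ := by
      ext
      simp only
      omega
    rw [hmk, Function.update_idem]

/-- Testing a counter that is too large decrements it `C` times. -/
theorem emptying_reaches_test_last (x : Fin 2) (q : M.Q) (k : ℕ) :
    ∀ (m : ℕ) (hm : m + k = C) (n : Fin 2 → ℕ), k < n x →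
    (M.emptying C).Reaches ⟨Sum.inr (.test, x, q, ⟨m, by omega⟩), n⟩ []
      ⟨Sum.inr (.test, x, q, ⟨C, by omega⟩), Function.update n x (n x - k)⟩ := by
  induction k with
  | zero =>
    intro m hm n hn
    obtain rfl : m = C := by omega
    simpa using .refl _
  | succ k ih =>
    intro m hm n hn
    have h0 : n x ≠ 0 := by omega
    have hmC : m < C := by omega
    refine .step (M := M.emptying C)
      (c' := ⟨Sum.inr (.down, x, q, ⟨m, by omega⟩), n⟩)
      (by simp [TCMI.step, emptying, h0, hmC]) ?_
    refine .step (M := M.emptying C)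
      (c' := ⟨Sum.inr (.test, x, q, ⟨m + 1, by omega⟩), Function.update n x (n x - 1)⟩)
      (by simp [TCMI.step, emptying, h0, hmC]) ?_
    convert ih (m + 1) (by omega) (Function.update n x (n x - 1)) (by simp; omega) using 2
    simp
    congr 1
    omega

/-- In a wait state of `M` the simulating machine goes on to wait, with the values of the counters
recoverable from its configuration. -/
theorem emptying_reaches_wait {q : M.Q} {l : InputSymbol b → M.Q} (hq : M.instr q = .input l)
    (n : Fin 2 → ℕ) :
    ∃ (x : Fin 2) (m : Fin (C + 1)) (n' : Fin 2 → ℕ),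
      (M.emptying C).Reaches ⟨Sum.inl q, n⟩ [] ⟨Sum.inr (.hold, x, q, m), n'⟩ ∧
      Function.update n' x (n' x + m) = n ∧ (n 0 ≤ C ∨ n 1 ≤ C → n' x = 0) := by
  have hstart : (M.emptying C).step ⟨Sum.inl q, n⟩ = some ⟨Sum.inr (.test, 0, q, 0), n⟩ := by
    simp [TCMI.step, emptying, hq, mapInstr]
  by_cases h0 : n 0 ≤ C
  · have h := emptying_reaches_hold (M := M) (C := C) 0 q (n 0) 0 (by omega) n rfl
    exact ⟨0, _, _, .step hstart h, by simp, by simp⟩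
  · have h := emptying_reaches_test_last (M := M) (C := C) 0 q C 0 (by omega) n (by omega)
    have h' : (M.emptying C).Reaches ⟨Sum.inr (.test, 0, q, ⟨C, by omega⟩),
        Function.update n 0 (n 0 - C)⟩ [] ⟨Sum.inr (.test, 1, q, 0), n⟩ := by
      refine .step (M := M.emptying C)
        (c' := ⟨Sum.inr (.back, 0, q, ⟨C, by omega⟩), Function.update n 0 (n 0 - C)⟩)
        (by simp [TCMI.step, emptying]; omega) ?_
      have h2 := emptying_reaches_back (M := M) (C := C) q C (by omega)
        (Function.update n 0 (n 0 - C))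
      rwa [Function.update_self, Nat.sub_add_cancel (by omega), Function.update_idem,
        Function.update_eq_self] at h2
    have hreach := (Reaches.step hstart h).trans h'
    by_cases h1 : n 1 ≤ C
    · have h3 := emptying_reaches_hold (M := M) (C := C) 1 q (n 1) 0 (by omega) n rfl
      exact ⟨1, _, _, hreach.trans h3, by simp, by simp⟩
    · have h3 := emptying_reaches_test_last (M := M) (C := C) 1 q C 0 (by omega) n (by omega)
      refine ⟨1, ⟨C, by omega⟩, Function.update n 1 (n 1 - C), 
        (hreach.trans h3).trans (.step ?_ (.refl _)), ?_, by omega⟩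
      · simp [TCMI.step, emptying]
      · rw [Function.update_self, Nat.sub_add_cancel (by omega), Function.update_idem,
          Function.update_eq_self]

theorem Reaches.emptying {c c' : M.Config} {I : List (InputSymbol b)} (h : M.Reaches c I c')
    (C : ℕ) : (M.emptying C).Reaches ⟨Sum.inl c.state, c.counter⟩ I
      ⟨Sum.inl c'.state, c'.counter⟩ := by
  induction h with
  | refl c => exact .refl _
  | @step c c' c'' I hs _ ih =>
    refine .step ?_ ih
    unfold TCMI.step at hs ⊢
    rcases hi : M.instr c.state with ⟨x, l⟩ | ⟨x, l⟩ | ⟨x, l, l'⟩ | l | l | _ <;>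
      simp only [hi, reduceCtorEq] at hs <;> simp only [TCMI.emptying, hi, mapInstr]
    · obtain rfl := Option.some.inj hs
      rfl
    · split at hs
      · simp at hs
      · rename_i h0
        obtain rfl := Option.some.inj hs
        simp [h0]
    · obtain rfl := Option.some.inj hs
      simp only [Option.some.injEq, Config.mk.injEq, and_true]
      split <;> rfl
    · obtain rfl := Option.some.inj hs
      rfl
  | @read c c'' l a I hs _ ih =>
    obtain ⟨x, m, n', hr, hn', -⟩ := emptying_reaches_wait (C := C) hs c.counter
    have hup := emptying_reaches_up x (l a) m.1 m.2 n'
    rw [hn'] at hup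
    refine hr.trans (.read (M := M.emptying C)
      (l := fun a => Sum.inr (.up, x, M.afterRead c.state a, m)) rfl ?_)
    have : M.afterRead c.state a = l a := by simp [afterRead, hs]
    rw [this]
    exact hup.trans ih

theorem Counts.emptying (hM : M.Counts) (C : ℕ) : (M.emptying C).Counts := by
  intro I
  obtain ⟨c, hc, hH, h0, h1⟩ := hM I
  refine ⟨_, hc.emptying C, ?_, h0, h1⟩
  unfold IsHalt at hH ⊢
  simp [TCMI.emptying, hH, mapInstr]

end TCMI

theorem mainTheorem8 (b : ℕ) (hb : 2 ≤ b) (h : ∃ M : TCMI b, M.Counts) :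
    ∃ M : TCMI b, M.Counts ∧ M.HasEmptyCounterAtWaits := by
  obtain ⟨M, hM⟩ := h
  obtain ⟨C, hC⟩ := hM.exists_bound hb
  refine ⟨M.emptying C, hM.emptying C, fun I => ?_⟩
  obtain ⟨c, hc, -⟩ := hM I
  obtain ⟨c', hc', l, hl⟩ := hc.exists_wait
  obtain ⟨x, m, n', hr, -, hn'⟩ := TCMI.emptying_reaches_wait (C := C) hl c'.counter
  have h := (hc'.emptying C).trans hr
  rw [List.append_nil] at h
  refine ⟨_, h, ⟨_, rfl⟩, ?_⟩
  have h0 := hn' (hC I c' hc' ⟨l, hl⟩)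
  rw [Nat.min_eq_zero_iff]
  rcases (by decide : ∀ x : Fin 2, x = 0 ∨ x = 1) x with rfl | rfl
  · exact .inl h0
  · exact .inr h0
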